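/- Let $X$ be a real Hilbert space and let $A,B\colon X\rightrightarrows X$ be maximally monotone operators. Write $\operatorname{dom}A=\{x\in X: Ax\neq\varnothing\}$, $\operatorname{ran}A=\bigcup_{x\in X}Ax$, and let $A^{-1}$ be the inverse operator ($x\in A^{-1}u\iff u\in Ax$). For a maximally monotone operator $C$ let $J_C=(\mathrm{Id}+C)^{-1}$ be its resolvent (a single-valued map $X\to X$), let $R_A=2J_A-\mathrm{Id}$, and let $T=\mathrm{Id}-J_A+J_BR_A$ be the Douglas--Rachford operator. Put $D=\operatorname{dom}A-\operatorname{dom}B$, $R=\operatorname{ran}A+\operatorname{ran}B$ (Minkowski difference and sum), and assume that $$\overline{\operatorname{ran}}(\mathrm{Id}-T)=\overline{D\cap R}=\overline{D}\cap\overline{R}.$$ Let $v$, $v_D$, $v_R$ be the projections of $0$ onto the nonempty closed convex sets $\overline{\operatorname{ran}}(\mathrm{Id}-T)$, $\overline{D}$, $\overline{R}$, respectively. Then for every $x\in X$, as $n\to\infty$: 1. $\|J_AT^nx-J_AT^{n+1}x\|^2+\|J_{A^{-1}}T^nx-J_{A^{-1}}T^{n+1}x\|^2\to\|v\|^2$,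 and $\|v\|^2=\|v_D\|^2+\|v_R\|^2$; 2. $J_AT^nx-J_AT^{n+1}x\to v_R$; 3. $J_{A^{-1}}T^nx-J_{A^{-1}}T^{n+1}x\to v_D$. All limits of vectors are limits in norm. -/

import Mathlib

open Filter Topology
open scoped Pointwise InnerProductSpace

namespace DouglasRachford

/-! A set-valued operator on `X` is a map `A : X → Set X`. -/

section Operators

variable {X : Type*}

/-- The domain `dom A = {x | A x ≠ ∅}`. -/
def dom (A : X → Set X) : Set X := {x | (A x).Nonempty}

/-- The range `ran A = ⋃ x, A x`. -/
def ran (A : X → Set X) : Set X := ⋃ x, A x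

/-- The inverse operator: `x ∈ A⁻¹ u` if and only if `u ∈ A x`. -/
def inverse (A : X → Set X) : X → Set X := fun u => {x | u ∈ A x}

end Operators

section Hilbert

variable {X : Type*} [NormedAddCommGroup X] [InnerProductSpace ℝ X]

/-- `A` is monotone: `⟪x - y, u - w⟫ ≥ 0` for all `(x, u)`, `(y, w)` in the graph of `A`. -/
def IsMonotone (A : X → Set X) : Prop :=
  ∀ x y : X, ∀ u ∈ A x, ∀ w ∈ A y, 0 ≤ ⟪x - y, u - w⟫_ℝ

/-- `A` is maximally monotone: it is monotone, and every monotone operator whose graph contains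
the graph of `A` is equal to `A`. -/
def IsMaximallyMonotone (A : X → Set X) : Prop :=
  IsMonotone A ∧ ∀ A' : X → Set X, IsMonotone A' → (∀ x, A x ⊆ A' x) → A' = A

/-- The operator `Id + A`, that is, `x ↦ {x + u | u ∈ A x}`. -/
def idAdd (A : X → Set X) : X → Set X := fun x => {x} + A x

/-- The resolvent `J_A = (Id + A)⁻¹` as a map `X → X`. By Minty's theorem `(Id + A)⁻¹ x` is a
singleton for every `x` when `A` is maximally monotone; `resolvent A x` is its element.
(If `(Id + A)⁻¹ x` is empty, the value is arbitrary.) -/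
noncomputable def resolvent (A : X → Set X) (x : X) : X :=
  Classical.epsilon fun p => p ∈ inverse (idAdd A) x

/-- The reflected resolvent `R_A = 2 J_A - Id`. -/
noncomputable def reflectedResolvent (A : X → Set X) (x : X) : X :=
  (2 : ℝ) • resolvent A x - x

/-- The Douglas--Rachford operator `T = Id - J_A + J_B R_A`. -/
noncomputable def drOperator (A B : X → Set X) (x : X) : X :=
  x - resolvent A x + resolvent B (reflectedResolvent A x)

/-- `p` is a nearest point to `x` in `C`. -/
def IsNearest (C : Set X) (x p : X) : Prop :=
  p ∈ C ∧ ∀ q ∈ C, ‖x - p‖ ≤ ‖x - q‖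

/-- The projection `P_C x`: the nearest point to `x` in `C`. It exists and is unique when `C` is
a nonempty closed convex subset of a Hilbert space (`isNearest_proj`, `IsNearest.unique`). -/
noncomputable def proj (C : Set X) (x : X) : X :=
  Classical.epsilon (IsNearest C x)

/-- The displacement range `ran (Id - T)`. -/
def displacementRange (A B : X → Set X) : Set X :=
  Set.range fun x => x - drOperator A B x

/-- The minimal displacement vector `v`, the projection of `0` onto the closure of
`ran (Id - T)`. -/
noncomputable def minDisplacement (A B : X → Set X) : X :=
  proj (closure (displacementRange A B)) 0

/-- `v_D`, the projection of `0` onto the closure of `dom A - dom B`. -/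
noncomputable def vD (A B : X → Set X) : X := proj (closure (dom A - dom B)) 0

/-- `v_R`, the projection of `0` onto the closure of `ran A + ran B`. -/
noncomputable def vR (A B : X → Set X) : X := proj (closure (ran A + ran B)) 0

/-! Sanity facts: the chosen values are the intended ones. -/

theorem IsMonotone.eq_of_mem {A : X → Set X} (hA : IsMonotone A) {x p q : X}
    (hp : p ∈ inverse (idAdd A) x) (hq : q ∈ inverse (idAdd A) x) : p = q := by
  obtain ⟨_, rfl, u, hu, hpu⟩ := Set.mem_add.1 hp
  obtain ⟨_, rfl, w, hw, hqw⟩ := Set.mem_add.1 hq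
  have h := hA _ _ u hu w hw
  rename_i a b
  have e : u - w = -(a - b) := by
    rw [eq_sub_of_add_eq' hpu, eq_sub_of_add_eq' hqw]; abel
  rw [e, inner_neg_right, real_inner_self_eq_norm_sq] at h
  have : ‖a - b‖ = 0 := by nlinarith [norm_nonneg (a - b)]
  exact sub_eq_zero.1 (norm_eq_zero.1 this)

theorem IsMonotone.resolvent_eq {A : X → Set X} (hA : IsMonotone A) {x p : X}
    (hp : p ∈ inverse (idAdd A) x) : resolvent A x = p :=
  hA.eq_of_mem (Classical.epsilon_spec (p := fun p => p ∈ inverse (idAdd A) x) ⟨p, hp⟩) hp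

theorem isNearest_proj [CompleteSpace X] {C : Set X} (hne : C.Nonempty) (hcl : IsClosed C)
    (hco : Convex ℝ C) (x : X) : IsNearest C x (proj C x) := by
  obtain ⟨p, hp, h⟩ := exists_norm_eq_iInf_of_complete_convex hne hcl.isComplete hco x
  refine Classical.epsilon_spec (p := IsNearest C x) ⟨p, hp, fun q hq => ?_⟩
  rw [h]
  exact ciInf_le ⟨0, by rintro _ ⟨z, rfl⟩; exact norm_nonneg _⟩ (⟨q, hq⟩ : C)

theorem IsNearest.unique {C : Set X} (hco : Convex ℝ C) {x p q : X}
    (hp : IsNearest C x p) (hq : IsNearest C x q) : p = q := by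
  have hm : (2⁻¹ : ℝ) • p + (2⁻¹ : ℝ) • q ∈ C :=
    hco hp.1 hq.1 (by norm_num) (by norm_num) (by norm_num)
  have h1 := hp.2 _ hm
  have h2 := le_antisymm (hp.2 _ hq.1) (hq.2 _ hp.1)
  have h3 := parallelogram_law_with_norm ℝ (x - p) (x - q)
  have e1 : x - p + (x - q) = (2 : ℝ) • (x - ((2⁻¹ : ℝ) • p + (2⁻¹ : ℝ) • q)) := by
    module
  have e2 : x - p - (x - q) = -(p - q) := by abel
  rw [e1, e2, norm_smul, norm_neg, ← h2] at h3
  norm_num at h3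
  have : ‖p - q‖ = 0 := by nlinarith [norm_nonneg (p - q), norm_nonneg (x - p)]
  exact sub_eq_zero.1 (norm_eq_zero.1 this)

end Hilbert

end DouglasRachford

namespace DouglasRachford

open Set

section Basic

variable {X : Type*} {A : X → Set X}

/-! Let y = Tⁿx. The increment J_A y - J_A Ty lies in R, and J_{A⁻¹} y - J_{A⁻¹} Ty lies in D. They
add up to y - Ty, and monotonicity makes their inner product nonnegative, so their squared norms sum
to at most ‖y - Ty‖². As T is firmly nonexpansive, this bound tends to ‖v‖²
(`tendsto_iterate_sub_iterate_succ`). Once ‖v‖² = ‖v_D‖² + ‖v_R‖², each increment is squeezed to the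
minimal norm in its convex set, hence converges to the nearest point.

The Pythagorean identity rests on `inner_eq_zero_and_add_mem`: a direction bounded above on the
domain of a maximally monotone operator is a recession direction of the closure of its range. So the
closure of R is invariant under ±v_D, whence v_D ⟂ v_R, and v_D + v_R lies in both closures; the
assumed equality of closures identifies it with v. Convexity and recession both come from Minty's
theorem, proved via the Fitzpatrick function. -/

theorem ran_inverse (A : X → Set X) : ran (inverse A) = dom A := by
  ext x; simp [ran, dom, inverse, Set.Nonempty]

theorem dom_inverse (A : X → Set X) : dom (inverse A) = ran A := by
  ext x; simp [ran, dom, inverse, Set.Nonempty]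

theorem mem_ran {x u : X} (h : u ∈ A x) : u ∈ ran A := mem_iUnion.2 ⟨x, h⟩

theorem mem_dom {x u : X} (h : u ∈ A x) : x ∈ dom A := ⟨u, h⟩

end Basic

/-! ### Closures and recession directions of Minkowski sums -/

section Sums

variable {G : Type*} [TopologicalSpace G] [AddCommSemigroup G] [ContinuousAdd G] {U V : Set G}

theorem add_mem_closure_add {p q : G} (hp : p ∈ closure U) (hq : q ∈ closure V) :
    p + q ∈ closure (U + V) :=
  map_mem_closure₂ continuous_add hp hq fun _ ha _ hb => add_mem_add ha hb

theorem closure_add_closure (U V : Set G) : closure (closure U + closure V) = closure (U + V) := by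
  refine Subset.antisymm (closure_minimal ?_ isClosed_closure)
    (closure_mono (add_subset_add subset_closure subset_closure))
  rintro _ ⟨p, hp, q, hq, rfl⟩
  exact add_mem_closure_add hp hq

theorem add_mem_closure_add_of_left {u : G} (h : ∀ y ∈ closure U, y + u ∈ closure U) :
    ∀ y ∈ closure (U + V), y + u ∈ closure (U + V) := by
  intro y hy
  have := map_mem_closure (f := fun y => y + u) (by fun_prop) hy (t := closure (U + V)) (by
    rintro _ ⟨p, hp, q, hq, rfl⟩
    change p + q + u ∈ _
    rw [add_right_comm]
    exact add_mem_closure_add (h p (subset_closure hp)) (subset_closure hq))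
  rwa [closure_closure] at this

theorem add_mem_closure_add_of_right {u : G} (h : ∀ y ∈ closure V, y + u ∈ closure V) :
    ∀ y ∈ closure (U + V), y + u ∈ closure (U + V) := by
  rw [add_comm U V]
  exact add_mem_closure_add_of_left h

end Sums

/-! ### Proximal points -/

section Minimization

variable {H : Type*} [NormedAddCommGroup H] [InnerProductSpace ℝ H]

/-- A supremum of affine functions that stays bounded below after adding `‖·‖² / 2` has a
proximal point at `0`, characterized by its variational inequality. -/
theorem exists_prox_zero_of_affine [CompleteSpace H] {ι : Type*} (c : ι → H) (k : ι → ℝ) (b : ℝ)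
    (hb : ∀ z s, (∀ i, ⟪z, c i⟫_ℝ - k i ≤ s) → b ≤ s + ‖z‖ ^ 2 / 2)
    (hne : ∃ z s, ∀ i, ⟪z, c i⟫_ℝ - k i ≤ s) :
    ∃ z₀ s₀, (∀ i, ⟪z₀, c i⟫_ℝ - k i ≤ s₀) ∧
      ∀ z s, (∀ i, ⟪z, c i⟫_ℝ - k i ≤ s) → 0 ≤ s - s₀ + ⟪z₀, z - z₀⟫_ℝ := by
  -- The supremum may be infinite, so upper bounds stand in for its values.
  set S : Set ℝ := {t | ∃ z, ∀ i, ⟪z, c i⟫_ℝ - k i ≤ t - ‖z‖ ^ 2 / 2} with hS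
  have hSne : S.Nonempty := by
    obtain ⟨z, s, h⟩ := hne
    exact ⟨s + ‖z‖ ^ 2 / 2, z, fun i => by linarith [h i]⟩
  have hSb : BddBelow S := ⟨b, by
    rintro t ⟨z, h⟩
    linarith [hb z _ h]⟩
  set m := sInf S with hm
  have hmin : ∀ z s, (∀ i, ⟪z, c i⟫_ℝ - k i ≤ s) → m ≤ s + ‖z‖ ^ 2 / 2 := fun z s h =>
    csInf_le hSb ⟨z, fun i => by linarith [h i]⟩
  have happrox : ∀ n : ℕ, ∃ z, ∀ i, ⟪z, c i⟫_ℝ - k i ≤ m + 1 / (n + 1) - ‖z‖ ^ 2 / 2 := by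
    intro n
    have hpos : (0 : ℝ) < 1 / (n + 1) := Nat.one_div_pos_of_nat
    obtain ⟨t, ⟨z, hz⟩, ht⟩ := exists_lt_of_csInf_lt hSne (lt_add_of_pos_right m hpos)
    exact ⟨z, fun i => by linarith [hz i]⟩
  choose z hz using happrox
  -- Testing minimality at the midpoint, with the parallelogram law, makes the minimizing sequence
  -- Cauchy.
  have hdist : ∀ n p : ℕ, ‖z n - z p‖ ^ 2 ≤ 4 * (1 / (n + 1) + 1 / (p + 1)) := by
    intro n p
    have h := hmin ((2⁻¹ : ℝ) • (z n + z p))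
      (m + (1 / (n + 1) + 1 / (p + 1)) / 2 - (‖z n‖ ^ 2 + ‖z p‖ ^ 2) / 4) (fun i => by
        rw [real_inner_smul_left, inner_add_left]
        linarith [hz n i, hz p i])
    have h3 := parallelogram_law_with_norm ℝ (z n) (z p)
    rw [norm_smul, mul_pow] at h
    norm_num at h
    norm_num
    nlinarith
  have hlim : Tendsto (fun n : ℕ => (1 : ℝ) / (n + 1)) atTop (𝓝 0) :=
    tendsto_one_div_add_atTop_nhds_zero_nat
  have hcau : CauchySeq z := by
    rw [Metric.cauchySeq_iff]
    intro ε hε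
    have hev := hlim.eventually (gt_mem_nhds (show (0 : ℝ) < ε ^ 2 / 8 by positivity))
    obtain ⟨N, hN⟩ := hev.exists_forall_of_atTop
    refine ⟨N, fun n hn p hp => ?_⟩
    rw [dist_eq_norm]
    exact lt_of_pow_lt_pow_left₀ 2 hε.le (by linarith [hdist n p, hN n hn, hN p hp])
  obtain ⟨z₀, hz₀⟩ := cauchySeq_tendsto_of_complete hcau
  have h0 : ∀ i, ⟪z₀, c i⟫_ℝ - k i ≤ m - ‖z₀‖ ^ 2 / 2 := by
    intro i
    have h1 : Tendsto (fun n => ⟪z n, c i⟫_ℝ - k i) atTop (𝓝 (⟪z₀, c i⟫_ℝ - k i)) :=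
      (hz₀.inner tendsto_const_nhds).sub_const _
    have h2 : Tendsto (fun n : ℕ => m + 1 / ((n : ℝ) + 1) - ‖z n‖ ^ 2 / 2) atTop
        (𝓝 (m + 0 - ‖z₀‖ ^ 2 / 2)) :=
      (hlim.const_add m).sub ((hz₀.norm.pow 2).div_const 2)
    rw [add_zero] at h2
    exact le_of_tendsto_of_tendsto' h1 h2 fun n => hz n i
  refine ⟨z₀, m - ‖z₀‖ ^ 2 / 2, h0, fun w s hs => ?_⟩
  set g := s - (m - ‖z₀‖ ^ 2 / 2) + ⟪z₀, w - z₀⟫_ℝ with hg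
  -- Minimality along the segment from `z₀` to `w`, divided by `l`; then `l → 0`.
  have hl : ∀ l : ℝ, 0 < l → l ≤ 1 → 0 ≤ g + l * (‖w - z₀‖ ^ 2 / 2) := by
    intro l hl0 hl1
    have h := hmin (z₀ + l • (w - z₀)) ((1 - l) * (m - ‖z₀‖ ^ 2 / 2) + l * s) (fun i => by
      have e : ⟪z₀ + l • (w - z₀), c i⟫_ℝ - k i
          = (1 - l) * (⟪z₀, c i⟫_ℝ - k i) + l * (⟪w, c i⟫_ℝ - k i) := by
        rw [inner_add_left, real_inner_smul_left, inner_sub_left]; ring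
      rw [e]
      exact add_le_add (mul_le_mul_of_nonneg_left (h0 i) (by linarith))
        (mul_le_mul_of_nonneg_left (hs i) hl0.le))
    rw [norm_add_sq_real, real_inner_smul_right, norm_smul, mul_pow, Real.norm_eq_abs, sq_abs] at h
    have : 0 ≤ l * (g + l * (‖w - z₀‖ ^ 2 / 2)) := by rw [hg]; linarith
    exact nonneg_of_mul_nonneg_right this hl0
  have ht : Tendsto (fun l : ℝ => g + l * (‖w - z₀‖ ^ 2 / 2)) (𝓝[>] 0) (𝓝 g) := by
    have : Tendsto (fun l : ℝ => g + l * (‖w - z₀‖ ^ 2 / 2)) (𝓝 0)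
        (𝓝 (g + 0 * (‖w - z₀‖ ^ 2 / 2))) := (Continuous.tendsto (by fun_prop) 0)
    rw [zero_mul, add_zero] at this
    exact this.mono_left nhdsWithin_le_nhds
  refine ge_of_tendsto ht ?_
  filter_upwards [Ioc_mem_nhdsGT (zero_lt_one' ℝ)] with l h using hl l h.1 h.2

end Minimization

/-! ### Maximal monotonicity and Minty's theorem -/

section Operators

variable {X : Type*} [NormedAddCommGroup X] [InnerProductSpace ℝ X] {A B C : X → Set X}

theorem IsMonotone.inverse (hA : IsMonotone A) : IsMonotone (inverse A) := by
  intro x y u hu w hw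
  rw [real_inner_comm]
  exact hA u w x hu y hw

/-- A point monotonically related to the graph of a maximally monotone operator is in it. -/
theorem IsMaximallyMonotone.mem (hA : IsMaximallyMonotone A) {x u : X}
    (h : ∀ y, ∀ w ∈ A y, 0 ≤ ⟪x - y, u - w⟫_ℝ) : u ∈ A x := by
  have hmono : IsMonotone fun z => A z ∪ {w | z = x ∧ w = u} := by
    rintro y z w (hw | ⟨rfl, rfl⟩) w' (hw' | ⟨rfl, rfl⟩)
    · exact hA.1 y z w hw w' hw'
    · have := h y w hw
      rwa [← neg_sub, ← neg_sub w, inner_neg_neg] at this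
    · exact h z w' hw'
    · simp
  rw [← hA.2 _ hmono fun z => subset_union_left]
  exact Or.inr ⟨rfl, rfl⟩

theorem IsMaximallyMonotone.inverse (hA : IsMaximallyMonotone A) :
    IsMaximallyMonotone (inverse A) := by
  refine ⟨hA.1.inverse, fun A' hA' hsub => ?_⟩
  funext u
  refine Subset.antisymm (fun x hx => ?_) (hsub u)
  refine hA.mem fun y w hw => ?_
  rw [real_inner_comm]
  exact hA' u w x hx y (hsub w hw)

theorem IsMaximallyMonotone.exists_mem (hA : IsMaximallyMonotone A) : ∃ x, ∃ u, u ∈ A x := by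
  by_contra! h
  exact h 0 0 (hA.mem fun y w hw => absurd hw (h y w))

/-- The core of Minty's theorem, by minimizing the Fitzpatrick function plus `‖·‖² / 2`. -/
theorem exists_neg_mem_of_forall_mem [CompleteSpace X] (hmono : IsMonotone A)
    (hmax : ∀ x u, (∀ y, ∀ w ∈ A y, 0 ≤ ⟪x - y, u - w⟫_ℝ) → u ∈ A x) : ∃ x, -x ∈ A x := by
  let ι := {p : X × X // p.2 ∈ A p.1}
  -- Swapping the coordinates makes the supremum of `⟪z, c p⟫ - k p` the Fitzpatrick function.
  let c : ι → WithLp 2 (X × X) := fun p => WithLp.toLp 2 (p.1.2, p.1.1)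
  let k : ι → ℝ := fun p => ⟪p.1.1, p.1.2⟫_ℝ
  have hinner : ∀ (z : WithLp 2 (X × X)) (p : ι),
      ⟪z, c p⟫_ℝ = ⟪z.fst, p.1.2⟫_ℝ + ⟪z.snd, p.1.1⟫_ℝ := fun z p =>
    WithLp.prod_inner_apply _ _
  have hnorm : ∀ z : WithLp 2 (X × X), ‖z‖ ^ 2 = ‖z.fst‖ ^ 2 + ‖z.snd‖ ^ 2 := fun z =>
    WithLp.prod_norm_sq_eq_of_L2 z
  -- A smaller bound would put `z` in the graph by maximality, where its own affine function takes
  -- the value `⟪z.fst, z.snd⟫`.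
  have hF : ∀ (z : WithLp 2 (X × X)) (s : ℝ), (∀ p : ι, ⟪z, c p⟫_ℝ - k p ≤ s) →
      ⟪z.fst, z.snd⟫_ℝ ≤ s := by
    intro z s h
    by_contra! hlt
    have hz : z.snd ∈ A z.fst := by
      refine hmax _ _ fun y w hw => ?_
      have := h ⟨(y, w), hw⟩
      rw [hinner] at this
      simp only [k] at this
      rw [inner_sub_left, inner_sub_right, inner_sub_right, real_inner_comm z.snd y]
      linarith
    have := h ⟨(z.fst, z.snd), hz⟩
    rw [hinner] at this
    simp only [k] at this
    rw [real_inner_comm z.fst z.snd] at this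
    linarith
  have hgraph : ∀ q : ι, ∀ p : ι,
      ⟪WithLp.toLp 2 q.1, c p⟫_ℝ - k p ≤ ⟪q.1.1, q.1.2⟫_ℝ := by
    rintro ⟨⟨y, w⟩, hw⟩ ⟨⟨y', w'⟩, hw'⟩
    have := hmono y y' w hw w' hw'
    rw [hinner]
    simp only [k]
    rw [inner_sub_left, inner_sub_right, inner_sub_right, real_inner_comm w y'] at this
    change ⟪y, w'⟫_ℝ + ⟪w, y'⟫_ℝ - ⟪y', w'⟫_ℝ ≤ ⟪y, w⟫_ℝ
    linarith
  obtain ⟨z₀, s₀, h0, hvi⟩ := exists_prox_zero_of_affine c k 0 (fun z s h => by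
      have h1 := hF z s h
      have h2 := norm_add_sq_real z.fst z.snd
      rw [hnorm]
      nlinarith [sq_nonneg ‖z.fst + z.snd‖]) (by
      by_cases hne : Nonempty ι
      · obtain ⟨q⟩ := hne
        exact ⟨_, _, hgraph q⟩
      · exact ⟨0, 0, fun i => absurd ⟨i⟩ hne⟩)
  have hs := hF z₀ s₀ h0
  set x := z₀.fst
  set u := z₀.snd
  -- Thus (-u, -x) is monotonically related to the graph, so it belongs to it; the same bound tested
  -- there forces x + u = 0.
  have key : ∀ y, ∀ w ∈ A y, ‖x + u‖ ^ 2 ≤ ⟪-u - y, -x - w⟫_ℝ := by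
    intro y w hw
    have h := hvi _ _ (hgraph ⟨(y, w), hw⟩)
    have e : ⟪z₀, WithLp.toLp 2 (y, w) - z₀⟫_ℝ = ⟪x, y - x⟫_ℝ + ⟪u, w - u⟫_ℝ :=
      WithLp.prod_inner_apply _ _
    change 0 ≤ ⟪y, w⟫_ℝ - s₀ + ⟪z₀, WithLp.toLp 2 (y, w) - z₀⟫_ℝ at h
    rw [e, inner_sub_right, inner_sub_right, real_inner_self_eq_norm_sq,
      real_inner_self_eq_norm_sq] at h
    rw [norm_add_sq_real, inner_sub_left, inner_sub_right, inner_sub_right, inner_neg_neg,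
      inner_neg_left, inner_neg_right, real_inner_comm x u, real_inner_comm x y]
    linarith
  have hmem : -x ∈ A (-u) := hmax _ _ fun y w hw => (sq_nonneg _).trans (key y w hw)
  have h := key _ _ hmem
  rw [sub_self, inner_zero_left] at h
  have hxu : x + u = 0 := by
    rw [← norm_eq_zero]
    exact pow_eq_zero_iff two_ne_zero |>.1 (le_antisymm h (sq_nonneg _))
  rw [← eq_neg_of_add_eq_zero_left hxu] at hmem
  exact ⟨x, hmem⟩

/-- Minty's theorem: `Id + ε⁻¹ A` is surjective. -/
theorem IsMaximallyMonotone.exists_sub_smul_mem [CompleteSpace X] (hA : IsMaximallyMonotone A)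
    (y : X) {ε : ℝ} (hε : 0 < ε) : ∃ x, y - ε • x ∈ A x := by
  have e : ∀ u w : X, ε • u + y - (ε • w + y) = ε • (u - w) := fun u w => by module
  -- The operator `x ↦ ε⁻¹ (A x - y)`.
  obtain ⟨x, hx⟩ := exists_neg_mem_of_forall_mem (A := fun x => {w | ε • w + y ∈ A x})
    (fun x z u hu w hw => by
      have := hA.1 x z _ hu _ hw
      rw [e, real_inner_smul_right] at this
      exact nonneg_of_mul_nonneg_right this hε)
    (fun x u h => hA.mem fun z w hw => by
      have := h z (ε⁻¹ • (w - y)) (by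
        change ε • ε⁻¹ • (w - y) + y ∈ A z
        rwa [smul_inv_smul₀ hε.ne', sub_add_cancel])
      have e' : ε • u + y - w = ε • (u - ε⁻¹ • (w - y)) := by
        rw [smul_sub, smul_inv_smul₀ hε.ne']; abel
      rw [e', real_inner_smul_right]
      exact mul_nonneg hε.le this)
  refine ⟨x, ?_⟩
  have : ε • -x + y ∈ A x := hx
  rwa [smul_neg, neg_add_eq_sub] at this

/-! ### Resolvents and firm nonexpansiveness -/

section Resolvent

variable [CompleteSpace X]

theorem IsMaximallyMonotone.sub_resolvent_mem (hA : IsMaximallyMonotone A) (x : X) :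
    x - resolvent A x ∈ A (resolvent A x) := by
  obtain ⟨p, hp⟩ := hA.exists_sub_smul_mem x one_pos
  rw [one_smul] at hp
  have : resolvent A x = p :=
    hA.1.resolvent_eq (mem_add.2 ⟨p, rfl, x - p, hp, add_sub_cancel _ _⟩)
  rwa [this]

theorem IsMaximallyMonotone.resolvent_inverse (hA : IsMaximallyMonotone A) (x : X) :
    resolvent (DouglasRachford.inverse A) x = x - resolvent A x :=
  hA.1.inverse.resolvent_eq
    (mem_add.2 ⟨_, rfl, resolvent A x, hA.sub_resolvent_mem x, sub_add_cancel _ _⟩)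

theorem IsMaximallyMonotone.inner_resolvent_nonneg (hA : IsMaximallyMonotone A) (x y : X) :
    0 ≤ ⟪resolvent A x - resolvent A y, (x - resolvent A x) - (y - resolvent A y)⟫_ℝ :=
  hA.1 _ _ _ (hA.sub_resolvent_mem x) _ (hA.sub_resolvent_mem y)

/-- The Douglas--Rachford operator is firmly nonexpansive. -/
theorem drOperator_firmly_nonexpansive (hA : IsMaximallyMonotone A) (hB : IsMaximallyMonotone B)
    (x y : X) :
    ‖drOperator A B x - drOperator A B y‖ ^ 2
      + ‖(x - drOperator A B x) - (y - drOperator A B y)‖ ^ 2 ≤ ‖x - y‖ ^ 2 := by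
  have h1 := hA.inner_resolvent_nonneg x y
  have h2 := hB.inner_resolvent_nonneg (reflectedResolvent A x) (reflectedResolvent A y)
  set p := resolvent A x - resolvent A y with hp
  set q := resolvent B (reflectedResolvent A x) - resolvent B (reflectedResolvent A y) with hq
  obtain ⟨d, hd⟩ : ∃ d, d = x - y := ⟨_, rfl⟩
  have e1 : (x - resolvent A x) - (y - resolvent A y) = d - p := by rw [hd, hp]; abel
  have e2 : (reflectedResolvent A x - resolvent B (reflectedResolvent A x))
      - (reflectedResolvent A y - resolvent B (reflectedResolvent A y))
      = (2 : ℝ) • p - d - q := by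
    rw [hd, hp, hq]; simp only [reflectedResolvent]; module
  have e3 : drOperator A B x - drOperator A B y = d - p + q := by
    rw [hd, hp, hq]; simp only [drOperator]; abel
  have e4 : (x - drOperator A B x) - (y - drOperator A B y) = p - q := by
    rw [hp, hq]; simp only [drOperator]; abel
  rw [e1] at h1
  rw [e2] at h2
  rw [e3, e4, ← hd, norm_add_sq_real, norm_sub_sq_real d p, norm_sub_sq_real p q, inner_sub_left]
  rw [inner_sub_right, real_inner_self_eq_norm_sq] at h1
  rw [inner_sub_right, inner_sub_right, real_inner_smul_right, real_inner_self_eq_norm_sq] at h2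
  linarith [real_inner_comm p d, real_inner_comm q d, real_inner_comm q p]

end Resolvent

/-! ### Convexity and recession directions of closures of ranges -/

section Ranges

/-- Minty's theorem supplies `y - ε • x ∈ C x`; the assumed estimate keeps `ε * ‖x‖ ^ 2` bounded, so
`ε • x → 0` as `ε → 0`. -/
theorem IsMaximallyMonotone.mem_closure_ran [CompleteSpace X] (hC : IsMaximallyMonotone C)
    {y b : X} {K : ℝ}
    (h : ∀ ε > 0, ∀ x, y - ε • x ∈ C x → ε * ‖x‖ ^ 2 ≤ K + ε * ⟪b, x⟫_ℝ) :
    y ∈ closure (ran C) := by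
  have hx : ∀ n : ℕ, ∃ x, y - ((1 : ℝ) / (n + 1)) • x ∈ C x := fun n =>
    hC.exists_sub_smul_mem y Nat.one_div_pos_of_nat
  choose x hx using hx
  have hlim : Tendsto (fun n : ℕ => (1 : ℝ) / (n + 1)) atTop (𝓝 0) :=
    tendsto_one_div_add_atTop_nhds_zero_nat
  have hbound : ∀ n : ℕ, ‖((1 : ℝ) / (n + 1)) • x n‖ ^ 2
      ≤ (1 : ℝ) / (n + 1) * (2 * K) + (1 : ℝ) / (n + 1) * ((1 : ℝ) / (n + 1)) * ‖b‖ ^ 2 := by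
    intro n
    have hpos : (0 : ℝ) < 1 / (n + 1) := Nat.one_div_pos_of_nat
    have h1 := h _ hpos _ (hx n)
    set ε : ℝ := 1 / (n + 1)
    rw [norm_smul, mul_pow, Real.norm_eq_abs, sq_abs]
    have h2 := norm_sub_sq_real b (x n)
    have h3 : ⟪b, x n⟫_ℝ ≤ (‖b‖ ^ 2 + ‖x n‖ ^ 2) / 2 := by nlinarith [sq_nonneg ‖b - x n‖]
    have h4 : ε * ‖x n‖ ^ 2 ≤ 2 * K + ε * ‖b‖ ^ 2 := by
      linarith [mul_le_mul_of_nonneg_left h3 hpos.le]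
    linarith [mul_le_mul_of_nonneg_left h4 hpos.le]
  have hzero : Tendsto (fun n : ℕ => ‖((1 : ℝ) / (n + 1)) • x n‖ ^ 2) atTop (𝓝 0) := by
    refine squeeze_zero (fun n => sq_nonneg _) hbound ?_
    simpa using (hlim.mul_const (2 * K)).add ((hlim.mul hlim).mul_const (‖b‖ ^ 2))
  have hzero' : Tendsto (fun n : ℕ => ((1 : ℝ) / (n + 1)) • x n) atTop (𝓝 0) := by
    rw [tendsto_zero_iff_norm_tendsto_zero]
    simpa [Real.sqrt_sq (norm_nonneg _)] using hzero.sqrt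
  refine mem_closure_of_tendsto (f := fun n : ℕ => y - ((1 : ℝ) / (n + 1)) • x n) ?_
    (b := atTop) (Eventually.of_forall fun n => mem_ran (hx n))
  simpa using hzero'.const_sub y

theorem IsMaximallyMonotone.convex_closure_ran [CompleteSpace X] (hC : IsMaximallyMonotone C) :
    Convex ℝ (closure (ran C)) := by
  have key : ∀ s t : ℝ, 0 ≤ s → 0 ≤ t → s + t = 1 → ∀ y ∈ ran C, ∀ z ∈ ran C,
      s • y + t • z ∈ closure (ran C) := by
    intro s t hs ht hst y hy z hz
    obtain ⟨p, hp⟩ := mem_iUnion.1 hy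
    obtain ⟨q, hq⟩ := mem_iUnion.1 hz
    -- `b` and `K` are read off the convex combination of the monotonicity inequalities against (p,
    -- y) and (q, z); the terms linear in `x` alone cancel.
    refine hC.mem_closure_ran (b := s • p + t • q)
      (K := - (s * ⟪p, s • y + t • z - y⟫_ℝ + t * ⟪q, s • y + t • z - z⟫_ℝ))
      fun ε hε x hx => ?_
    set w := s • y + t • z with hw
    have h1 := mul_nonneg hs (hC.1 _ _ _ hx _ hp)
    have h2 := mul_nonneg ht (hC.1 _ _ _ hx _ hq)
    have e : s * ⟪x, w - y⟫_ℝ + t * ⟪x, w - z⟫_ℝ = 0 := by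
      rw [← real_inner_smul_right, ← real_inner_smul_right, ← inner_add_right]
      have : s • (w - y) + t • (w - z) = 0 := by
        have : s • (w - y) + t • (w - z) = (s + t) • w - (s • y + t • z) := by module
        rw [this, hst, one_smul, hw, sub_self]
      rw [this, inner_zero_right]
    have e1 : ∀ a r : X, ⟪x - a, w - ε • x - r⟫_ℝ
        = ⟪x, w - r⟫_ℝ - ⟪a, w - r⟫_ℝ - ε * ‖x‖ ^ 2 + ε * ⟪a, x⟫_ℝ := by
      intro a r
      rw [sub_right_comm, inner_sub_right, real_inner_smul_right, inner_sub_left, inner_sub_left,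
        real_inner_self_eq_norm_sq]
      ring
    rw [e1] at h1 h2
    rw [inner_add_left, real_inner_smul_left, real_inner_smul_left]
    have e2 : ε * ‖x‖ ^ 2 = (s + t) * (ε * ‖x‖ ^ 2) := by rw [hst, one_mul]
    linarith
  intro y hy z hz s t hs ht hst
  have := map_mem_closure₂ (f := fun y z : X => s • y + t • z) (by fun_prop) hy hz
    (u := closure (ran C)) (key s t hs ht hst)
  rwa [closure_closure] at this

/-- If `⟪·, u⟫` is bounded above on `dom C`, then `u` is a recession direction of
`closure (ran C)`. -/
theorem IsMaximallyMonotone.add_mem_closure_ran [CompleteSpace X] (hC : IsMaximallyMonotone C)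
    {u : X} {M : ℝ} (hu : ∀ x ∈ dom C, ⟪x, u⟫_ℝ ≤ M) {y : X} (hy : y ∈ closure (ran C)) :
    y + u ∈ closure (ran C) := by
  have key : MapsTo (fun y => y + u) (ran C) (closure (ran C)) := by
    intro y hy
    obtain ⟨p, hp⟩ := mem_iUnion.1 hy
    refine hC.mem_closure_ran (b := p) (K := M - ⟪p, u⟫_ℝ) fun ε hε x hx => ?_
    have h := hC.1 _ _ _ hx _ hp
    have e : y + u - ε • x - y = u - ε • x := by abel
    rw [e, inner_sub_right, inner_sub_left, real_inner_smul_right, inner_sub_left,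
      real_inner_self_eq_norm_sq] at h
    linarith [hu x (mem_dom hx)]
  have := map_mem_closure (by fun_prop) hy key
  rwa [closure_closure] at this

end Ranges

/-! ### Nearest points to the origin -/

section Sets

variable {S U V : Set X}

theorem convex_closure_add (hU : Convex ℝ (closure U)) (hV : Convex ℝ (closure V)) :
    Convex ℝ (closure (U + V)) := by
  rw [← closure_add_closure]
  exact (hU.add hV).closure

theorem IsNearest.norm_sq_le_inner (hS : Convex ℝ S) {p q : X} (hp : IsNearest S 0 p)
    (hq : q ∈ S) : ‖p‖ ^ 2 ≤ ⟪q, p⟫_ℝ := by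
  have h : ∀ w ∈ S, ⟪(0 : X) - p, w - p⟫_ℝ ≤ 0 := by
    rw [← norm_eq_iInf_iff_real_inner_le_zero hS hp.1]
    have : Nonempty S := ⟨⟨p, hp.1⟩⟩
    exact le_antisymm (le_ciInf fun w => hp.2 w w.2)
      (ciInf_le ⟨0, by rintro _ ⟨z, rfl⟩; exact norm_nonneg _⟩ (⟨p, hp.1⟩ : S))
  have := h q hq
  rw [zero_sub, inner_neg_left, inner_sub_right, real_inner_self_eq_norm_sq,
    real_inner_comm q p] at this
  linarith

theorem IsNearest.norm_sub_sq_le (hS : Convex ℝ S) {p q : X} (hp : IsNearest S 0 p)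
    (hq : q ∈ S) : ‖q - p‖ ^ 2 ≤ ‖q‖ ^ 2 - ‖p‖ ^ 2 := by
  rw [norm_sub_sq_real]
  linarith [hp.norm_sq_le_inner hS hq]

theorem IsNearest.inner_eq_zero_of_invariant (hS : Convex ℝ S) {p u : X} (hp : IsNearest S 0 p)
    (h1 : ∀ y ∈ S, y + u ∈ S) (h2 : ∀ y ∈ S, y + -u ∈ S) : ⟪p, u⟫_ℝ = 0 := by
  have i1 := hp.norm_sq_le_inner hS (h1 p hp.1)
  have i2 := hp.norm_sq_le_inner hS (h2 p hp.1)
  rw [inner_add_left, real_inner_self_eq_norm_sq] at i1 i2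
  rw [inner_neg_left] at i2
  rw [real_inner_comm]
  linarith

end Sets

/-! ### Asymptotic regularity and orthogonal decomposition -/

section Displacement

/-- The asymptotic regularity theorem of Baillon, Bruck and Reich for firmly nonexpansive maps. -/
theorem tendsto_iterate_sub_iterate_succ {T : X → X}
    (hT : ∀ x y, ‖T x - T y‖ ^ 2 + ‖(x - T x) - (y - T y)‖ ^ 2 ≤ ‖x - y‖ ^ 2)
    {v : X} (hco : Convex ℝ (closure (range fun x => x - T x)))
    (hv : IsNearest (closure (range fun x => x - T x)) 0 v) (x : X) :
    Tendsto (fun n : ℕ => T^[n] x - T^[n + 1] x) atTop (𝓝 v) := by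
  have hmem : ∀ y (n : ℕ), T^[n] y - T^[n + 1] y ∈ closure (range fun x => x - T x) := fun y n =>
    subset_closure ⟨T^[n] y, by simp only [Function.iterate_succ_apply']⟩
  -- Squared distances between two orbits decrease, and their drops dominate the squared difference
  -- of displacements.
  have hdiff : ∀ y, Tendsto
      (fun n : ℕ => (T^[n] x - T^[n + 1] x) - (T^[n] y - T^[n + 1] y)) atTop (𝓝 0) := by
    intro y
    have hstep : ∀ n : ℕ, ‖(T^[n] x - T^[n + 1] x) - (T^[n] y - T^[n + 1] y)‖ ^ 2
        ≤ ‖T^[n] x - T^[n] y‖ ^ 2 - ‖T^[n + 1] x - T^[n + 1] y‖ ^ 2 := by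
      intro n
      have := hT (T^[n] x) (T^[n] y)
      simp only [Function.iterate_succ_apply']
      linarith
    have hanti : Antitone fun n : ℕ => ‖T^[n] x - T^[n] y‖ ^ 2 :=
      antitone_nat_of_succ_le fun n => sub_nonneg.1 ((sq_nonneg _).trans (hstep n))
    have hl := tendsto_atTop_ciInf hanti ⟨0, by rintro _ ⟨n, rfl⟩; positivity⟩
    have hz := hl.sub (hl.comp (tendsto_add_atTop_nat 1))
    rw [sub_self] at hz
    have hsq := (squeeze_zero (fun n => sq_nonneg _) hstep hz).sqrt
    rw [tendsto_zero_iff_norm_tendsto_zero]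
    simpa [Real.sqrt_sq (norm_nonneg _)] using hsq
  have hdec : ∀ y (n : ℕ), ‖T^[n] y - T^[n + 1] y‖ ≤ ‖y - T y‖ := by
    intro y n
    induction n with
    | zero => simp
    | succ n ih =>
      refine le_trans ?_ ih
      have := hT (T^[n] y) (T^[n + 1] y)
      rw [Function.iterate_succ_apply' T (n + 1), Function.iterate_succ_apply' T n] at *
      refine (sq_le_sq₀ (norm_nonneg _) (norm_nonneg _)).1 ?_
      linarith [sq_nonneg ‖T^[n] y - T (T^[n] y) - (T (T^[n] y) - T (T (T^[n] y)))‖]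
  rw [Metric.tendsto_atTop]
  intro ε hε
  -- Displacement norms do not increase along an orbit, so an almost minimal start `y` keeps its
  -- whole orbit's displacements within `ε / 2` of `v`.
  obtain ⟨_, hw, y, rfl⟩ : ∃ w, ‖w‖ ^ 2 < ‖v‖ ^ 2 + (ε / 2) ^ 2 ∧
      w ∈ range fun x => x - T x := by
    have hopen : IsOpen {w : X | ‖w‖ ^ 2 < ‖v‖ ^ 2 + (ε / 2) ^ 2} :=
      isOpen_lt (by fun_prop) continuous_const
    exact mem_closure_iff.1 hv.1 _ hopen
      (lt_add_of_pos_right (‖v‖ ^ 2) (show 0 < (ε / 2) ^ 2 by positivity))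
  have hy : ∀ n : ℕ, ‖(T^[n] y - T^[n + 1] y) - v‖ < ε / 2 := by
    intro n
    refine lt_of_pow_lt_pow_left₀ 2 (by positivity) ?_
    have h1 := hv.norm_sub_sq_le hco (hmem y n)
    have h2 := pow_le_pow_left₀ (norm_nonneg _) (hdec y n) 2
    linarith [show ‖y - T y‖ ^ 2 < ‖v‖ ^ 2 + (ε / 2) ^ 2 from hw]
  obtain ⟨N, hN⟩ := Metric.tendsto_atTop.1 (hdiff y) (ε / 2) (by positivity)
  refine ⟨N, fun n hn => ?_⟩
  have h1 := hN n hn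
  rw [dist_zero_right] at h1
  rw [dist_eq_norm]
  calc _ = ‖((T^[n] x - T^[n + 1] x) - (T^[n] y - T^[n + 1] y))
        + ((T^[n] y - T^[n + 1] y) - v)‖ := by congr 1; abel
    _ ≤ _ := norm_add_le _ _
    _ < ε := by linarith [hy n]

/-- The orthogonal decomposition of the minimal displacement vector. -/
theorem inner_eq_zero_and_add_mem [CompleteSpace X]
    (hA : IsMaximallyMonotone A) (hB : IsMaximallyMonotone B) {p q : X}
    (hco : Convex ℝ (closure (dom A - dom B))) (hco' : Convex ℝ (closure (ran A + ran B)))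
    (hp : IsNearest (closure (dom A - dom B)) 0 p)
    (hq : IsNearest (closure (ran A + ran B)) 0 q) :
    ⟪p, q⟫_ℝ = 0 ∧ p + q ∈ closure (dom A - dom B) ∩ closure (ran A + ran B) := by
  obtain ⟨a, a', ha⟩ := hA.exists_mem
  obtain ⟨b, b', hb⟩ := hB.exists_mem
  have hD : ∀ x ∈ dom A, ∀ y ∈ dom B, ‖p‖ ^ 2 ≤ ⟪x, p⟫_ℝ - ⟪y, p⟫_ℝ := fun x hx y hy => by
    rw [← inner_sub_left]
    exact hp.norm_sq_le_inner hco (subset_closure (sub_mem_sub hx hy))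
  have hR : ∀ x ∈ ran A, ∀ y ∈ ran B, ‖q‖ ^ 2 ≤ ⟪x, q⟫_ℝ + ⟪y, q⟫_ℝ := fun x hx y hy => by
    rw [← inner_add_left]
    exact hq.norm_sq_le_inner hco' (subset_closure (add_mem_add hx hy))
  -- Fixing a point of `dom B` in `hD` bounds `⟪·, -p⟫` above on `dom A`; the other three cases are
  -- analogous, through inverses for domains.
  have rA : ∀ y ∈ closure (ran A), y + -p ∈ closure (ran A) := fun y hy =>
    hA.add_mem_closure_ran (M := -⟪b, p⟫_ℝ) (fun x hx => by
      rw [inner_neg_right]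
      linarith [hD x hx b (mem_dom hb), sq_nonneg ‖p‖]) hy
  have rB : ∀ y ∈ closure (ran B), y + p ∈ closure (ran B) := fun y hy =>
    hB.add_mem_closure_ran (M := ⟪a, p⟫_ℝ) (fun x hx => by
      linarith [hD a (mem_dom ha) x hx, sq_nonneg ‖p‖]) hy
  have dA : ∀ y ∈ closure (dom A), y + -q ∈ closure (dom A) := fun y hy => by
    rw [← ran_inverse] at *
    refine hA.inverse.add_mem_closure_ran (M := ⟪b', q⟫_ℝ) (fun x hx => ?_) hy
    rw [dom_inverse] at hx
    rw [inner_neg_right]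
    linarith [hR x hx b' (mem_ran hb), sq_nonneg ‖q‖]
  have dB : ∀ y ∈ closure (dom B), y + -q ∈ closure (dom B) := fun y hy => by
    rw [← ran_inverse] at *
    refine hB.inverse.add_mem_closure_ran (M := ⟪a', q⟫_ℝ) (fun x hx => ?_) hy
    rw [dom_inverse] at hx
    rw [inner_neg_right]
    linarith [hR a' (mem_ran ha) x hx, sq_nonneg ‖q‖]
  have dB' : ∀ y ∈ closure (-dom B), y + q ∈ closure (-dom B) := fun y hy => by
    rw [← neg_closure, Set.mem_neg] at *
    rw [neg_add]
    exact dB _ hy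
  have R1 := add_mem_closure_add_of_left (V := ran B) rA
  have R2 := add_mem_closure_add_of_right (U := ran A) rB
  have D2 := add_mem_closure_add_of_right (U := dom A) dB'
  rw [← sub_eq_add_neg] at D2
  refine ⟨?_, D2 p hp.1, ?_⟩
  · rw [real_inner_comm]
    exact hq.inner_eq_zero_of_invariant hco' R2 R1
  · rw [add_comm p]
    exact R2 q hq.1

/-- If a vector of a convex set asymptotically has at most the minimal norm, then it tends to the
nearest point to `0`. -/
theorem IsNearest.tendsto_of_norm_sq_tendsto {S : Set X} (hS : Convex ℝ S) {p : X}
    (hp : IsNearest S 0 p) {f : ℕ → X} (hf : ∀ n, f n ∈ S) {g : ℕ → ℝ}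
    (hfg : ∀ n, ‖f n‖ ^ 2 ≤ g n) (hg : Tendsto g atTop (𝓝 (‖p‖ ^ 2))) :
    Tendsto f atTop (𝓝 p) := by
  have h0 : Tendsto (fun n => g n - ‖p‖ ^ 2) atTop (𝓝 0) := by
    rw [← sub_self (‖p‖ ^ 2)]
    exact hg.sub_const _
  have hsq := (squeeze_zero (fun n => sq_nonneg _)
    (fun n => (hp.norm_sub_sq_le hS (hf n)).trans (sub_le_sub_right (hfg n) _)) h0).sqrt
  rw [tendsto_iff_norm_sub_tendsto_zero]
  simpa [Real.sqrt_sq (norm_nonneg _)] using hsq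

end Displacement

end Operators

end DouglasRachford

/-! ### Limits of the resolvent increments -/

theorem mainTheorem7 {X : Type*} [NormedAddCommGroup X] [InnerProductSpace ℝ X] [CompleteSpace X]
    (A B : X → Set X)
    (hA : DouglasRachford.IsMaximallyMonotone A) (hB : DouglasRachford.IsMaximallyMonotone B)
    (hDR : closure (DouglasRachford.displacementRange A B) =
      closure ((DouglasRachford.dom A - DouglasRachford.dom B) ∩
        (DouglasRachford.ran A + DouglasRachford.ran B)))
    (hDR' : closure ((DouglasRachford.dom A - DouglasRachford.dom B) ∩
        (DouglasRachford.ran A + DouglasRachford.ran B)) =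
      closure (DouglasRachford.dom A - DouglasRachford.dom B) ∩
        closure (DouglasRachford.ran A + DouglasRachford.ran B))
    (x : X) :
    let T : X → X := DouglasRachford.drOperator A B
    let J : X → X := DouglasRachford.resolvent A
    let J' : X → X := DouglasRachford.resolvent (DouglasRachford.inverse A)
    let v : X := DouglasRachford.minDisplacement A B
    let vD : X := DouglasRachford.vD A B
    let vR : X := DouglasRachford.vR A B
    (Tendsto (fun n : ℕ => ‖J (T^[n] x) - J (T^[n + 1] x)‖ ^ 2
        + ‖J' (T^[n] x) - J' (T^[n + 1] x)‖ ^ 2) atTop (𝓝 (‖v‖ ^ 2)) ∧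
      ‖v‖ ^ 2 = ‖vD‖ ^ 2 + ‖vR‖ ^ 2) ∧
    Tendsto (fun n : ℕ => J (T^[n] x) - J (T^[n + 1] x)) atTop (𝓝 vR) ∧
    Tendsto (fun n : ℕ => J' (T^[n] x) - J' (T^[n + 1] x)) atTop (𝓝 vD) := by
  intro T J J' v vD vR
  have hcoD : Convex ℝ (closure (DouglasRachford.dom A - DouglasRachford.dom B)) := by
    rw [sub_eq_add_neg]
    have hcA := hA.inverse.convex_closure_ran
    have hcB := hB.inverse.convex_closure_ran
    rw [DouglasRachford.ran_inverse] at hcA hcB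
    refine DouglasRachford.convex_closure_add hcA ?_
    rw [← neg_closure]
    exact hcB.neg
  have hcoR : Convex ℝ (closure (DouglasRachford.ran A + DouglasRachford.ran B)) :=
    DouglasRachford.convex_closure_add hA.convex_closure_ran hB.convex_closure_ran
  have hset := hDR.trans hDR'
  have hcoI : Convex ℝ (closure (DouglasRachford.displacementRange A B)) := by
    rw [hset]
    exact hcoD.inter hcoR
  obtain ⟨a, a', ha⟩ := hA.exists_mem
  obtain ⟨b, b', hb⟩ := hB.exists_mem
  have nD : DouglasRachford.IsNearest _ 0 vD := DouglasRachford.isNearest_proj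
    ⟨_, subset_closure (Set.sub_mem_sub (DouglasRachford.mem_dom ha)
      (DouglasRachford.mem_dom hb))⟩ isClosed_closure hcoD 0
  have nR : DouglasRachford.IsNearest _ 0 vR := DouglasRachford.isNearest_proj
    ⟨_, subset_closure (Set.add_mem_add (DouglasRachford.mem_ran ha)
      (DouglasRachford.mem_ran hb))⟩ isClosed_closure hcoR 0
  have nv : DouglasRachford.IsNearest _ 0 v := DouglasRachford.isNearest_proj
    ⟨_, subset_closure (Set.mem_range_self (0 : X))⟩ isClosed_closure hcoI 0
  obtain ⟨horth, hmem⟩ := DouglasRachford.inner_eq_zero_and_add_mem hA hB hcoD hcoR nD nR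
  have hv : v = vD + vR := by
    refine nv.unique hcoI ⟨hset ▸ hmem, fun w hw => ?_⟩
    rw [hset] at hw
    have h1 := nD.norm_sq_le_inner hcoD hw.1
    have h2 := nR.norm_sq_le_inner hcoR hw.2
    have h3 := norm_add_sq_real vD vR
    have h4 := norm_sub_sq_real w (vD + vR)
    rw [inner_add_right] at h4
    rw [zero_sub, zero_sub, norm_neg, norm_neg]
    refine (sq_le_sq₀ (norm_nonneg _) (norm_nonneg _)).1 ?_
    linarith [sq_nonneg ‖w - (vD + vR)‖]
  have hnorm : ‖v‖ ^ 2 = ‖vD‖ ^ 2 + ‖vR‖ ^ 2 := by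
    rw [hv, norm_add_sq_real, horth]
    ring
  have hΔ : Tendsto (fun n : ℕ => T^[n] x - T^[n + 1] x) atTop (𝓝 v) :=
    DouglasRachford.tendsto_iterate_sub_iterate_succ
      (DouglasRachford.drOperator_firmly_nonexpansive hA hB) hcoI nv x
  have hJ' : ∀ y, J' y = y - J y := hA.resolvent_inverse
  have memR : ∀ y, J y - J (T y) ∈
      closure (DouglasRachford.ran A + DouglasRachford.ran B) := fun y => by
    have e : J y - J (T y) = (T y - J (T y))
        + (DouglasRachford.reflectedResolvent A y
          - DouglasRachford.resolvent B (DouglasRachford.reflectedResolvent A y)) := by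
      simp only [T, J, DouglasRachford.drOperator, DouglasRachford.reflectedResolvent]
      module
    rw [e]
    exact subset_closure (Set.add_mem_add (DouglasRachford.mem_ran (hA.sub_resolvent_mem _))
      (DouglasRachford.mem_ran (hB.sub_resolvent_mem _)))
  have memD : ∀ y, J' y - J' (T y) ∈
      closure (DouglasRachford.dom A - DouglasRachford.dom B) := fun y => by
    have e : J' y - J' (T y) = J (T y)
        - DouglasRachford.resolvent B (DouglasRachford.reflectedResolvent A y) := by
      rw [hJ', hJ']
      simp only [T, J, DouglasRachford.drOperator]
      abel
    rw [e]
    exact subset_closure (Set.sub_mem_sub (DouglasRachford.mem_dom (hA.sub_resolvent_mem _))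
      (DouglasRachford.mem_dom (hB.sub_resolvent_mem _)))
  have hle : ∀ y, ‖J y - J (T y)‖ ^ 2 + ‖J' y - J' (T y)‖ ^ 2 ≤ ‖y - T y‖ ^ 2 := fun y => by
    have h1 := hA.inner_resolvent_nonneg y (T y)
    have e : y - T y = (J y - J (T y)) + (J' y - J' (T y)) := by
      rw [hJ', hJ']
      abel
    rw [e, norm_add_sq_real, hJ', hJ']
    linarith
  have hsq := hΔ.norm.pow 2
  have lowD : ∀ y, ‖vD‖ ^ 2 ≤ ‖J' y - J' (T y)‖ ^ 2 := fun y => by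
    linarith [nD.norm_sub_sq_le hcoD (memD y), sq_nonneg ‖J' y - J' (T y) - vD‖]
  have lowR : ∀ y, ‖vR‖ ^ 2 ≤ ‖J y - J (T y)‖ ^ 2 := fun y => by
    linarith [nR.norm_sub_sq_le hcoR (memR y), sq_nonneg ‖J y - J (T y) - vR‖]
  simp only [Function.iterate_succ_apply'] at hsq ⊢
  have limR : Tendsto (fun n : ℕ => J (T^[n] x) - J (T (T^[n] x))) atTop (𝓝 vR) := by
    refine nR.tendsto_of_norm_sq_tendsto hcoR (fun n => memR _)
      -- The other increment uses up at least `‖vD‖ ^ 2` of the squared displacement, leaving `‖vR‖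
      -- ^ 2` in the limit.
      (g := fun n => ‖T^[n] x - T (T^[n] x)‖ ^ 2 - ‖vD‖ ^ 2)
      (fun n => by linarith [hle (T^[n] x), lowD (T^[n] x)]) ?_
    rw [← add_sub_cancel_left (‖vD‖ ^ 2) (‖vR‖ ^ 2), ← hnorm]
    exact hsq.sub_const _
  have limD : Tendsto (fun n : ℕ => J' (T^[n] x) - J' (T (T^[n] x))) atTop (𝓝 vD) := by
    refine nD.tendsto_of_norm_sq_tendsto hcoD (fun n => memD _)
      (g := fun n => ‖T^[n] x - T (T^[n] x)‖ ^ 2 - ‖vR‖ ^ 2)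
      (fun n => by linarith [hle (T^[n] x), lowR (T^[n] x)]) ?_
    rw [← add_sub_cancel_right (‖vD‖ ^ 2) (‖vR‖ ^ 2), ← hnorm]
    exact hsq.sub_const _
  refine ⟨⟨?_, hnorm⟩, limR, limD⟩
  rw [hnorm, add_comm]
  exact (limR.norm.pow 2).add (limD.norm.pow 2)
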